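/- Let $(X,Y)$ be a bivariate normal random vector with zero mean vector, variances $\sigma_X^2,\sigma_Y^2$ and correlation coefficient $\rho$, where $\sigma_X,\sigma_Y>0$ and $-1<\rho<1$, and let $Z=XY$. Let $n\ge 1$, let $Z_1,\dots,Z_n$ be independent random variables each with the same distribution as $Z$, and let $\overline{Z}=\frac1n(Z_1+\cdots+Z_n)$. Then the distribution of $\overline{Z}$ is absolutely continuous with respect to Lebesgue measure on $\mathbb{R}$, with probability density function $$p(x)=\frac{n^{(n+1)/2}\,2^{(1-n)/2}\,|x|^{(n-1)/2}}{(\sigma_X\sigma_Y)^{(n+1)/2}\sqrt{\pi(1-\rho^2)}\,\Gamma\big(\frac n2\big)}\exp\bigg(\frac{\rho n x}{\sigma_X\sigma_Y(1-\rho^2)}\bigg)K_{\frac{n-1}{2}}\bigg(\frac{n|x|}{\sigma_X\sigma_Y(1-\rho^2)}\bigg),\qquad x\in\mathbb{R}\setminus\{0\},$$ where $K_\nu(x)=\int_0^\infty \mathrm{e}^{-x\cosh(t)}\cosh(\nu t)\,\mathrm{d}t$ for $x>0$ is the modified Bessel function of the second kind. (The value assigned to $p$ at the single point $x=0$ is immaterial.)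 -/

import Mathlib

open MeasureTheory ProbabilityTheory

/-- The modified Bessel function of the second kind,
`K_ν(x) = ∫_0^∞ exp (-x cosh t) cosh (ν t) dt`; the integral converges for every `x > 0`. -/
noncomputable def besselK (ν x : ℝ) : ℝ :=
  ∫ t in Set.Ioi (0 : ℝ), Real.exp (-x * Real.cosh t) * Real.cosh (ν * t)

/-- The explicit density of the mean of `n` independent copies of the product of two centred
jointly normal variables with standard deviations `σX`, `σY` and correlation `ρ`.
All powers are real powers. The value at the single point `x = 0`, where `K_ν` is infinite,
is immaterial. -/
noncomputable def productMeanDensity (n : ℕ) (σX σY ρ x : ℝ) : ℝ :=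
  (n : ℝ) ^ (((n : ℝ) + 1) / 2) * (2 : ℝ) ^ ((1 - (n : ℝ)) / 2) * |x| ^ (((n : ℝ) - 1) / 2)
      / ((σX * σY) ^ (((n : ℝ) + 1) / 2) * Real.sqrt (Real.pi * (1 - ρ ^ 2))
          * Real.Gamma ((n : ℝ) / 2))
    * Real.exp (ρ * n * x / (σX * σY * (1 - ρ ^ 2)))
    * besselK (((n : ℝ) - 1) / 2) (n * |x| / (σX * σY * (1 - ρ ^ 2)))

/-! Both laws have the same finite moment generating function near zero, which determines a finite
measure (`MeasureTheory.Measure.ext_of_lintegral_exp_eq`). Put s = σXσY, r = 1 - ρ², and D(u) = 1 -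
2ρu - ru². Splitting Y into its regression on X and an independent Gaussian shows that XY has
transform D(ts)^(-1/2), so the mean of n copies has D(ts/n)^(-n/2). For the density, |y|^ν K_ν(α|y|)
is a Gamma-type mixture of Gaussian kernels, so its Laplace transform at b is a constant times (α² -
b²)^(-(ν+1/2)). With ν = (n-1)/2, α = ns⁻¹r⁻¹ and b = ρα + t one gets α² - b² = α² r D(ts/n), the
same power of D. Working with `lintegral` lets Tonelli apply before any convergence is known. -/

/-! ### Uniqueness from the moment generating function -/

/-- Two finite measures on `ℝ` whose moment generating functions are finite and agree near zero
are equal. -/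
theorem MeasureTheory.Measure.ext_of_lintegral_exp_eq {μ ν : Measure ℝ} [IsFiniteMeasure μ]
    [IsFiniteMeasure ν] {δ : ℝ} (hδ : 0 < δ)
    (hfin : ∀ t, |t| < δ → ∫⁻ x, ENNReal.ofReal (Real.exp (t * x)) ∂μ ≠ ⊤)
    (h : ∀ t, |t| < δ → ∫⁻ x, ENNReal.ofReal (Real.exp (t * x)) ∂μ
      = ∫⁻ x, ENNReal.ofReal (Real.exp (t * x)) ∂ν) : μ = ν := by
  have key : ∀ {κ : Measure ℝ} [IsFiniteMeasure κ],
      (∀ t, |t| < δ → ∫⁻ x, ENNReal.ofReal (Real.exp (t * x)) ∂κ ≠ ⊤) →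
      Set.Ioo (-δ) δ ⊆ interior (integrableExpSet id κ) := by
    intro κ _ hκ
    refine interior_maximal (fun t ht => ?_) isOpen_Ioo
    refine (lintegral_ofReal_ne_top_iff_integrable (by fun_prop) ?_).1 (hκ t (abs_lt.2 ht))
    exact Filter.Eventually.of_forall fun x => (Real.exp_pos _).le
  have hμ := key hfin
  have hν := key (κ := ν) fun t ht => by rw [← h t ht]; exact hfin t ht
  have hmgf : ∀ t, |t| < δ → mgf id μ t = mgf id ν t := by
    intro t ht
    simp only [mgf, id]
    rw [integral_eq_lintegral_of_nonneg_ae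
        (Filter.Eventually.of_forall fun x => (Real.exp_pos _).le) (by fun_prop),
      integral_eq_lintegral_of_nonneg_ae
        (Filter.Eventually.of_forall fun x => (Real.exp_pos _).le) (by fun_prop), h t ht]
  -- Both complex transforms are analytic on this vertical strip and agree on its real segment. The
  -- identity theorem carries the equality to the imaginary axis, where they are characteristic
  -- functions.
  set S : Set ℂ := {z | z.re ∈ Set.Ioo (-δ) δ} with hS
  have hEq : Set.EqOn (complexMGF id μ) (complexMGF id ν) S := by
    refine AnalyticOnNhd.eqOn_of_preconnected_of_frequently_eq (z₀ := 0)
      (analyticOnNhd_complexMGF.mono fun z hz => hμ hz)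
      (analyticOnNhd_complexMGF.mono fun z hz => hν hz)
      ((convex_Ioo (-δ) δ).linear_preimage Complex.reLm).isPreconnected (by simp [hS, hδ]) ?_
    have hev : ∀ᶠ x : ℝ in nhdsWithin 0 {0}ᶜ, complexMGF id μ x = complexMGF id ν x := by
      refine nhdsWithin_le_nhds ?_
      filter_upwards [Ioo_mem_nhds (neg_lt_zero.2 hδ) hδ] with t ht
      rw [complexMGF_ofReal, complexMGF_ofReal, hmgf t (abs_lt.2 ht)]
    have htend : Filter.Tendsto (fun x : ℝ => (x : ℂ)) (nhdsWithin 0 {0}ᶜ) (nhdsWithin 0 {0}ᶜ) := by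
      refine tendsto_nhdsWithin_iff.2 ⟨?_, ?_⟩
      · exact (Complex.continuous_ofReal.tendsto' 0 0 (by simp)).mono_left nhdsWithin_le_nhds
      · filter_upwards [self_mem_nhdsWithin] with x hx
        simpa using hx
    exact htend.frequently hev.frequently
  refine Measure.ext_of_charFun (funext fun t => ?_)
  rw [← complexMGF_id_mul_I, ← complexMGF_id_mul_I]
  exact hEq (by simp [hS, hδ])

/-! ### Gaussian integrals and the transform of XY -/

theorem lintegral_exp_mul_sub_sq_div (b : ℝ) {w : ℝ} (hw : 0 < w) :
    ∫⁻ x : ℝ, ENNReal.ofReal (Real.exp (b * x - x ^ 2 / (2 * w)))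
      = ENNReal.ofReal (√(2 * Real.pi * w) * Real.exp (b ^ 2 * w / 2)) := by
  have hv : w.toNNReal ≠ 0 := by simpa using hw
  have h1 := lintegral_gaussianPDFReal_eq_one (b * w) hv
  have hs : 0 < √(2 * Real.pi * w) := by positivity
  calc _ = ∫⁻ x : ℝ, ENNReal.ofReal (√(2 * Real.pi * w) * Real.exp (b ^ 2 * w / 2)) *
        ENNReal.ofReal (gaussianPDFReal (b * w) w.toNNReal x) := by
        refine lintegral_congr fun x => ?_
        rw [← ENNReal.ofReal_mul (by positivity)]
        congr 1
        rw [gaussianPDFReal, Real.coe_toNNReal _ hw.le]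
        rw [mul_mul_mul_comm, mul_inv_cancel₀ hs.ne', one_mul, ← Real.exp_add]
        congr 1
        field_simp
        ring
    _ = _ := by rw [lintegral_const_mul' _ _ ENNReal.ofReal_ne_top, h1, mul_one]

theorem lintegral_exp_mul_gaussianReal (t : ℝ) (v : NNReal) :
    ∫⁻ x, ENNReal.ofReal (Real.exp (t * x)) ∂(gaussianReal 0 v)
      = ENNReal.ofReal (Real.exp (v * t ^ 2 / 2)) := by
  have h := mgf_gaussianReal (p := gaussianReal 0 v) (X := id) (μ := 0) (v := v) (by simp) t
  rw [zero_mul, zero_add] at h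
  rw [← h, mgf, ofReal_integral_eq_lintegral_ofReal]
  · rfl
  · exact integrable_exp_mul_gaussianReal t
  · exact Filter.Eventually.of_forall fun x => (Real.exp_pos _).le

theorem lintegral_exp_mul_sq_gaussianReal (k : ℝ) {σ : ℝ} (hσ : 0 < σ)
    (hk : 0 < 1 - 2 * k * σ ^ 2) :
    ∫⁻ x, ENNReal.ofReal (Real.exp (k * x ^ 2)) ∂(gaussianReal 0 (σ ^ 2).toNNReal)
      = ENNReal.ofReal (√(1 - 2 * k * σ ^ 2))⁻¹ := by
  have hv : (σ ^ 2).toNNReal ≠ 0 := by simpa using hσ.ne'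
  have hc : (((σ ^ 2).toNNReal : NNReal) : ℝ) = σ ^ 2 := Real.coe_toNNReal _ (sq_nonneg σ)
  rw [gaussianReal_of_var_ne_zero _ hv,
    lintegral_withDensity_eq_lintegral_mul _ (measurable_gaussianPDF _ _) (by fun_prop)]
  have hw : 0 < σ ^ 2 / (1 - 2 * k * σ ^ 2) := by positivity
  have h := lintegral_exp_mul_sub_sq_div 0 hw
  calc _ = ∫⁻ x : ℝ, ENNReal.ofReal (√(2 * Real.pi * σ ^ 2))⁻¹ *
        ENNReal.ofReal (Real.exp (0 * x - x ^ 2 / (2 * (σ ^ 2 / (1 - 2 * k * σ ^ 2))))) := by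
        refine lintegral_congr fun x => ?_
        rw [Pi.mul_apply, gaussianPDF, gaussianPDFReal, hc, ← ENNReal.ofReal_mul (by positivity),
          ← ENNReal.ofReal_mul (by positivity), mul_assoc, ← Real.exp_add]
        congr 3
        field_simp
        ring
    _ = _ := by
        rw [lintegral_const_mul' _ _ ENNReal.ofReal_ne_top, h, ← ENNReal.ofReal_mul (by positivity)]
        congr 1
        rw [zero_pow two_ne_zero, zero_mul, zero_div, Real.exp_zero, mul_one, ← Real.sqrt_inv,
          ← Real.sqrt_inv, ← Real.sqrt_mul (by positivity)]
        congr 1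
        field_simp

/-- The moment generating function of the product of two centred jointly normal variables. -/
theorem ProbabilityTheory.HasGaussianLaw.lintegral_exp_mul_mul
    {Ω : Type*} [MeasurableSpace Ω] {P : Measure Ω} [IsProbabilityMeasure P]
    {X Y : Ω → ℝ} {σX σY ρ : ℝ} (hσX : 0 < σX) (hσY : 0 < σY) (hρ : -1 < ρ) (hρ' : ρ < 1)
    (hXY : HasGaussianLaw (fun ω => (X ω, Y ω)) P)
    (hX_mean : ∫ ω, X ω ∂P = 0) (hY_mean : ∫ ω, Y ω ∂P = 0)
    (hX_var : variance X P = σX ^ 2) (hY_var : variance Y P = σY ^ 2)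
    (hXY_cov : covariance X Y P = ρ * σX * σY) {t : ℝ}
    (ht : 0 < 1 - 2 * ρ * (t * (σX * σY)) - (1 - ρ ^ 2) * (t * (σX * σY)) ^ 2) :
    ∫⁻ ω, ENNReal.ofReal (Real.exp (t * (X ω * Y ω))) ∂P
      = ENNReal.ofReal
        (√(1 - 2 * ρ * (t * (σX * σY)) - (1 - ρ ^ 2) * (t * (σX * σY)) ^ 2))⁻¹ := by
  -- Regression coefficient of Y on X: it makes V uncorrelated with X, hence independent by joint
  -- normality.
  set c : ℝ := ρ * σY / σX with hc
  set V : Ω → ℝ := fun ω => Y ω - c * X ω with hV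
  have hX := hXY.fst
  have hY := hXY.snd
  have hρ2 : 0 < 1 - ρ ^ 2 := by nlinarith
  have hXV : HasGaussianLaw (fun ω => (X ω, V ω)) P :=
    hXY.map_fun ((ContinuousLinearMap.fst ℝ ℝ ℝ).prod
      (ContinuousLinearMap.snd ℝ ℝ ℝ - c • ContinuousLinearMap.fst ℝ ℝ ℝ))
  have hX2 := hX.memLp_two
  have hY2 := hY.memLp_two
  have hcov : covariance X V P = 0 := by
    rw [hV, covariance_fun_sub_right hX2 hY2 (hX2.const_mul c), covariance_const_mul_right,
      covariance_self hX.aemeasurable, hX_var, hXY_cov, hc]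
    field_simp
    ring
  have hVmean : ∫ ω, V ω ∂P = 0 := by
    rw [hV, integral_sub (hY2.integrable one_le_two) ((hX2.integrable one_le_two).const_mul c),
      integral_const_mul, hX_mean, hY_mean]
    simp
  have hVvar : variance V P = σY ^ 2 * (1 - ρ ^ 2) := by
    rw [hV, variance_fun_sub hY2 (hX2.const_mul c), variance_const_mul,
      covariance_const_mul_right, covariance_comm, hX_var, hY_var, hXY_cov, hc]
    field_simp
    ring
  have hVg := hXV.snd
  have hind := hXV.indepFun_of_covariance_eq_zero hcov
  have hmapX := hX.map_eq_gaussianReal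
  have hmapV := hVg.map_eq_gaussianReal
  rw [hX_mean, hX_var] at hmapX
  rw [hVmean, hVvar] at hmapV
  have hprod := (indepFun_iff_map_prod_eq_prod_map_map hX.aemeasurable hVg.aemeasurable).1 hind
  calc _ = ∫⁻ p : ℝ × ℝ, ENNReal.ofReal (Real.exp (t * (p.1 * (p.2 + c * p.1))))
          ∂(P.map fun ω => (X ω, V ω)) := by
        rw [lintegral_map' (by fun_prop) hXV.aemeasurable]
        refine lintegral_congr fun ω => ?_
        simp [hV]
    _ = ∫⁻ x, ∫⁻ v, ENNReal.ofReal (Real.exp (t * (x * (v + c * x)))) ∂(P.map V) ∂(P.map X) := by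
        rw [hprod, lintegral_prod _ (by fun_prop)]
    -- Integrating out v gives the Gaussian transform at tx, leaving a pure quadratic in x.
    _ = ∫⁻ x, ENNReal.ofReal (Real.exp ((t * c + t ^ 2 * (σY ^ 2 * (1 - ρ ^ 2)) / 2) * x ^ 2))
          ∂(P.map X) := by
        refine lintegral_congr fun x => ?_
        have h1 : ∀ v : ℝ, ENNReal.ofReal (Real.exp (t * (x * (v + c * x))))
            = ENNReal.ofReal (Real.exp (t * c * x ^ 2)) * ENNReal.ofReal (Real.exp (t * x * v)) := by
          intro v
          rw [← ENNReal.ofReal_mul (Real.exp_pos _).le, ← Real.exp_add]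
          congr 2
          ring
        simp_rw [h1]
        rw [lintegral_const_mul' _ _ ENNReal.ofReal_ne_top, hmapV, lintegral_exp_mul_gaussianReal,
          ← ENNReal.ofReal_mul (Real.exp_pos _).le, ← Real.exp_add,
          Real.coe_toNNReal _ (by positivity)]
        congr 2
        ring
    _ = _ := by
        have he : 1 - 2 * (t * c + t ^ 2 * (σY ^ 2 * (1 - ρ ^ 2)) / 2) * σX ^ 2
            = 1 - 2 * ρ * (t * (σX * σY)) - (1 - ρ ^ 2) * (t * (σX * σY)) ^ 2 := by
          rw [hc]
          field_simp
          ring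
        rw [hmapX, lintegral_exp_mul_sq_gaussianReal _ hσX (by rwa [he]), he]

/-! ### Bessel kernel and its Laplace transform -/

theorem lintegral_Ioi_exp_neg_mul_cosh (ν x : ℝ) :
    ∫⁻ t in Set.Ioi (0 : ℝ), ENNReal.ofReal (Real.exp (-x * Real.cosh t) * Real.cosh (ν * t))
      = ENNReal.ofReal (1 / 2) *
        ∫⁻ t, ENNReal.ofReal (Real.exp (-x * Real.cosh t) * Real.exp (ν * t)) := by
  set f : ℝ → ENNReal := fun t =>
    ENNReal.ofReal (Real.exp (-x * Real.cosh t) * Real.exp (ν * t)) with hf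
  have hfm : Measurable f := by
    have : Measurable fun t : ℝ => Real.exp (-x * Real.cosh t) * Real.exp (ν * t) :=
      (by fun_prop : Continuous fun t : ℝ =>
        Real.exp (-x * Real.cosh t) * Real.exp (ν * t)).measurable
    exact this.ennreal_ofReal
  have hneg : ∫⁻ t in Set.Iic (0 : ℝ), f t = ∫⁻ t in Set.Ioi (0 : ℝ), f (-t) := by
    have := (Measure.measurePreserving_neg (volume : Measure ℝ)).setLIntegral_comp_preimage
      (measurableSet_Iic (a := (0 : ℝ))) hfm
    rw [← this, setLIntegral_congr (Ioi_ae_eq_Ici (a := (0 : ℝ)))]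
    simp
  rw [← lintegral_add_compl f (measurableSet_Ioi (a := (0 : ℝ))), Set.compl_Ioi, hneg,
    ← lintegral_add_left hfm, ← lintegral_const_mul' _ _ ENNReal.ofReal_ne_top]
  refine lintegral_congr fun t => ?_
  simp only [hf]
  rw [← ENNReal.ofReal_add (by positivity) (by positivity),
    ← ENNReal.ofReal_mul (by norm_num), Real.cosh_neg, Real.cosh_eq (ν * t)]
  congr 1
  rw [mul_neg ν t]
  ring

theorem lintegral_Ioi_eq_lintegral_exp (g : ℝ → ENNReal) {c : ℝ} (hc : 0 < c) :
    ∫⁻ w in Set.Ioi (0 : ℝ), g w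
      = ∫⁻ t, ENNReal.ofReal (c * Real.exp t) * g (c * Real.exp t) := by
  have himg : (fun t => c * Real.exp t) '' Set.univ = Set.Ioi 0 := by
    rw [Set.image_univ]
    ext w
    constructor
    · rintro ⟨t, rfl⟩
      exact mul_pos hc (Real.exp_pos t)
    · intro hw
      refine ⟨Real.log (w / c), ?_⟩
      simp only
      rw [Real.exp_log (div_pos hw hc)]
      field_simp
  have h := lintegral_image_eq_lintegral_abs_deriv_mul (s := Set.univ)
    (f := fun t => c * Real.exp t) (f' := fun t => c * Real.exp t) MeasurableSet.univ
    (fun t _ => ((Real.hasDerivAt_exp t).const_mul c).hasDerivWithinAt)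
    (fun s _ t _ hst => Real.exp_injective (mul_left_cancel₀ hc.ne' hst)) g
  rw [himg, Measure.restrict_univ] at h
  rw [h]
  refine lintegral_congr fun t => ?_
  rw [abs_of_pos (mul_pos hc (Real.exp_pos t))]

/-- The representation of the Bessel kernel as a mixture of Gaussian kernels. -/
theorem rpow_mul_lintegral_exp_neg_mul_cosh (ν : ℝ) {α y : ℝ} (hα : 0 < α) (hy : y ≠ 0) :
    ENNReal.ofReal (|y| ^ ν) * ∫⁻ t in Set.Ioi (0 : ℝ),
        ENNReal.ofReal (Real.exp (-(α * |y|) * Real.cosh t) * Real.cosh (ν * t))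
      = ENNReal.ofReal (α ^ ν / 2) * ∫⁻ w in Set.Ioi (0 : ℝ),
        ENNReal.ofReal (w ^ (ν - 1) * Real.exp (-y ^ 2 / (2 * w) - α ^ 2 * w / 2)) := by
  have hy' : 0 < |y| := abs_pos.2 hy
  -- The substitution w = (|y|/α)eᵗ turns y²/(2w) + α²w/2 into α|y| cosh t.
  rw [lintegral_Ioi_exp_neg_mul_cosh, lintegral_Ioi_eq_lintegral_exp _ (div_pos hy' hα),
    ← mul_assoc, ← ENNReal.ofReal_mul (by positivity),
    ← lintegral_const_mul' _ _ ENNReal.ofReal_ne_top,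
    ← lintegral_const_mul' _ _ ENNReal.ofReal_ne_top]
  refine lintegral_congr fun t => ?_
  rw [← ENNReal.ofReal_mul (by positivity), ← ENNReal.ofReal_mul (by positivity),
    ← ENNReal.ofReal_mul (by positivity)]
  congr 1
  have hw : 0 < |y| / α * Real.exp t := by positivity
  have h1 : |y| / α * Real.exp t * (|y| / α * Real.exp t) ^ (ν - 1)
      = |y| ^ ν / α ^ ν * Real.exp (ν * t) := by
    rw [Real.rpow_sub_one hw.ne', mul_div_cancel₀ _ hw.ne',
      Real.mul_rpow (by positivity) (Real.exp_pos t).le, Real.div_rpow hy'.le hα.le,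
      ← Real.exp_mul, mul_comm t ν]
  have h2 : -y ^ 2 / (2 * (|y| / α * Real.exp t)) - α ^ 2 * (|y| / α * Real.exp t) / 2
      = -(α * |y|) * Real.cosh t := by
    rw [← sq_abs y, Real.cosh_eq, Real.exp_neg]
    field_simp
    ring
  rw [h2, ← mul_assoc (|y| / α * Real.exp t), h1]
  have hαν : 0 < α ^ ν := Real.rpow_pos_of_pos hα ν
  field_simp

theorem lintegral_rpow_mul_exp_neg_mul_Ioi {a r : ℝ} (ha : 0 < a) (hr : 0 < r) :
    ∫⁻ w in Set.Ioi (0 : ℝ), ENNReal.ofReal (w ^ (a - 1) * Real.exp (-(r * w)))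
      = ENNReal.ofReal ((1 / r) ^ a * Real.Gamma a) := by
  have h := Real.integral_rpow_mul_exp_neg_mul_Ioi ha hr
  have hpos : 0 < (1 / r) ^ a * Real.Gamma a :=
    mul_pos (Real.rpow_pos_of_pos (by positivity) a) (Real.Gamma_pos_of_pos ha)
  rw [← h, ofReal_integral_eq_lintegral_ofReal]
  -- A non-integrable function has Bochner integral 0, but the value here is positive.
  · by_contra hni
    rw [integral_undef hni] at h
    exact hpos.ne h
  · filter_upwards [ae_restrict_mem measurableSet_Ioi] with w hw
    exact mul_nonneg (Real.rpow_nonneg (le_of_lt hw) _) (Real.exp_pos _).le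

theorem measurable_lintegral_exp_neg_mul_cosh (ν : ℝ) :
    Measurable fun x : ℝ => ∫⁻ t in Set.Ioi (0 : ℝ),
      ENNReal.ofReal (Real.exp (-x * Real.cosh t) * Real.cosh (ν * t)) := by
  refine Measurable.lintegral_prod_right' (f := fun p : ℝ × ℝ =>
    ENNReal.ofReal (Real.exp (-p.1 * Real.cosh p.2) * Real.cosh (ν * p.2))) ?_
  exact (by fun_prop : Continuous fun p : ℝ × ℝ =>
    Real.exp (-p.1 * Real.cosh p.2) * Real.cosh (ν * p.2)).measurable.ennreal_ofReal

/-- The two-sided Laplace transform of `|y| ^ ν * K_ν (α |y|)`. -/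
theorem lintegral_exp_mul_rpow_mul_lintegral_cosh {ν α b : ℝ} (hν : 0 < ν + 1 / 2) (hα : 0 < α)
    (hb : |b| < α) :
    ∫⁻ y : ℝ, ENNReal.ofReal (Real.exp (b * y)) * (ENNReal.ofReal (|y| ^ ν) *
        ∫⁻ t in Set.Ioi (0 : ℝ),
          ENNReal.ofReal (Real.exp (-(α * |y|) * Real.cosh t) * Real.cosh (ν * t)))
      = ENNReal.ofReal (α ^ ν / 2 * (√(2 * Real.pi) *
          ((2 / (α ^ 2 - b ^ 2)) ^ (ν + 1 / 2) * Real.Gamma (ν + 1 / 2)))) := by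
  have hd : 0 < α ^ 2 - b ^ 2 := by
    have := sq_lt_sq' (abs_lt.1 hb).1 (abs_lt.1 hb).2
    linarith
  have hαν : 0 < α ^ ν := Real.rpow_pos_of_pos hα ν
  calc _ = ∫⁻ y : ℝ, ENNReal.ofReal (α ^ ν / 2) * ∫⁻ w in Set.Ioi (0 : ℝ),
          ENNReal.ofReal (Real.exp (b * y)) * ENNReal.ofReal
            (w ^ (ν - 1) * Real.exp (-y ^ 2 / (2 * w) - α ^ 2 * w / 2)) := by
        refine lintegral_congr_ae ?_
        filter_upwards [Measure.ae_ne volume (0 : ℝ)] with y hy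
        rw [rpow_mul_lintegral_exp_neg_mul_cosh ν hα hy,
          lintegral_const_mul' _ _ ENNReal.ofReal_ne_top]
        ring
    _ = ENNReal.ofReal (α ^ ν / 2) * ∫⁻ w in Set.Ioi (0 : ℝ), ∫⁻ y : ℝ,
          ENNReal.ofReal (Real.exp (b * y)) * ENNReal.ofReal
            (w ^ (ν - 1) * Real.exp (-y ^ 2 / (2 * w) - α ^ 2 * w / 2)) := by
        rw [lintegral_const_mul' _ _ ENNReal.ofReal_ne_top, lintegral_lintegral_swap]
        refine Measurable.aemeasurable ?_
        fun_prop
    _ = ENNReal.ofReal (α ^ ν / 2) * ∫⁻ w in Set.Ioi (0 : ℝ),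
          ENNReal.ofReal (√(2 * Real.pi)) * ENNReal.ofReal
            (w ^ (ν + 1 / 2 - 1) * Real.exp (-((α ^ 2 - b ^ 2) / 2 * w))) := by
        congr 1
        refine setLIntegral_congr_fun measurableSet_Ioi fun w hw => ?_
        have hw : 0 < w := hw
        have hwν : 0 < w ^ (ν - 1) := Real.rpow_pos_of_pos hw _
        have h1 : ∀ y : ℝ, ENNReal.ofReal (Real.exp (b * y)) * ENNReal.ofReal
            (w ^ (ν - 1) * Real.exp (-y ^ 2 / (2 * w) - α ^ 2 * w / 2))
            = ENNReal.ofReal (w ^ (ν - 1) * Real.exp (-(α ^ 2 * w / 2))) *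
              ENNReal.ofReal (Real.exp (b * y - y ^ 2 / (2 * w))) := by
          intro y
          rw [← ENNReal.ofReal_mul (by positivity), ← ENNReal.ofReal_mul (by positivity),
            mul_left_comm, mul_assoc, ← Real.exp_add, ← Real.exp_add]
          congr 3
          ring
        simp_rw [h1]
        rw [lintegral_const_mul' _ _ ENNReal.ofReal_ne_top, lintegral_exp_mul_sub_sq_div b hw,
          ← ENNReal.ofReal_mul (by positivity), ← ENNReal.ofReal_mul (by positivity),
          Real.sqrt_mul (by positivity)]
        congr 1
        rw [show ν + 1 / 2 - 1 = (ν - 1) + 1 / 2 by ring, Real.rpow_add hw, ← Real.sqrt_eq_rpow,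
          show -((α ^ 2 - b ^ 2) / 2 * w) = -(α ^ 2 * w / 2) + b ^ 2 * w / 2 by ring, Real.exp_add]
        ring
    _ = _ := by
        rw [lintegral_const_mul' _ _ ENNReal.ofReal_ne_top,
          lintegral_rpow_mul_exp_neg_mul_Ioi hν (by positivity),
          ← ENNReal.ofReal_mul (by positivity), ← ENNReal.ofReal_mul (by positivity), one_div_div]

theorem besselK_nonneg (ν x : ℝ) : 0 ≤ besselK ν x :=
  integral_nonneg fun _ => mul_nonneg (Real.exp_pos _).le (Real.cosh_pos _).le

theorem measurable_besselK (ν : ℝ) : Measurable (besselK ν) := by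
  refine StronglyMeasurable.measurable ?_
  refine StronglyMeasurable.integral_prod_right' (f := fun p : ℝ × ℝ =>
    Real.exp (-p.1 * Real.cosh p.2) * Real.cosh (ν * p.2)) ?_
  exact (by fun_prop : Continuous fun p : ℝ × ℝ =>
    Real.exp (-p.1 * Real.cosh p.2) * Real.cosh (ν * p.2)).stronglyMeasurable

theorem ofReal_besselK {ν x : ℝ}
    (h : ∫⁻ t in Set.Ioi (0 : ℝ),
      ENNReal.ofReal (Real.exp (-x * Real.cosh t) * Real.cosh (ν * t)) ≠ ⊤) :
    ENNReal.ofReal (besselK ν x) = ∫⁻ t in Set.Ioi (0 : ℝ),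
      ENNReal.ofReal (Real.exp (-x * Real.cosh t) * Real.cosh (ν * t)) := by
  have hnn : 0 ≤ᵐ[volume.restrict (Set.Ioi (0 : ℝ))]
      fun t => Real.exp (-x * Real.cosh t) * Real.cosh (ν * t) :=
    Filter.Eventually.of_forall fun t => mul_nonneg (Real.exp_pos _).le (Real.cosh_pos _).le
  rw [besselK, ofReal_integral_eq_lintegral_ofReal _ hnn]
  refine (lintegral_ofReal_ne_top_iff_integrable ?_ hnn).1 h
  exact (by fun_prop : Continuous fun t : ℝ =>
    Real.exp (-x * Real.cosh t) * Real.cosh (ν * t)).aestronglyMeasurable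

/-- The two-sided Laplace transform of `|y| ^ ν * K_ν (α |y|)`. -/
theorem lintegral_exp_mul_rpow_mul_besselK {ν α b : ℝ} (hν : 0 < ν + 1 / 2) (hα : 0 < α)
    (hb : |b| < α) :
    ∫⁻ y : ℝ, ENNReal.ofReal (Real.exp (b * y) * (|y| ^ ν * besselK ν (α * |y|)))
      = ENNReal.ofReal (√Real.pi * (2 * α) ^ ν * Real.Gamma (ν + 1 / 2) *
          (α ^ 2 - b ^ 2) ^ (-(ν + 1 / 2))) := by
  have hd : 0 < α ^ 2 - b ^ 2 := by
    have := sq_lt_sq' (abs_lt.1 hb).1 (abs_lt.1 hb).2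
    linarith
  have hK := lintegral_exp_mul_rpow_mul_lintegral_cosh hν hα hb
  -- Finiteness of the total integral makes the Bessel integral finite for almost every y, so no
  -- direct convergence estimate is needed.
  have hfin : ∀ᵐ y : ℝ, ENNReal.ofReal (Real.exp (b * y)) * (ENNReal.ofReal (|y| ^ ν) *
        ∫⁻ t in Set.Ioi (0 : ℝ),
          ENNReal.ofReal (Real.exp (-(α * |y|) * Real.cosh t) * Real.cosh (ν * t))) < ⊤ := by
    refine ae_lt_top ?_ (by rw [hK]; exact ENNReal.ofReal_ne_top)
    have := (measurable_lintegral_exp_neg_mul_cosh ν).comp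
      (by fun_prop : Measurable fun y : ℝ => α * |y|)
    simp only [Function.comp_def] at this
    fun_prop
  calc _ = _ := by
        refine lintegral_congr_ae ?_
        filter_upwards [Measure.ae_ne volume (0 : ℝ), hfin] with y hy hlt
        have hyν : 0 < |y| ^ ν := Real.rpow_pos_of_pos (abs_pos.2 hy) ν
        rw [ENNReal.ofReal_mul (by positivity), ENNReal.ofReal_mul hyν.le, ofReal_besselK]
        intro htop
        rw [htop, ENNReal.mul_top (by simpa using hyν), ENNReal.mul_top] at hlt
        · exact lt_irrefl _ hlt
        · simpa using Real.exp_pos (b * y)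
    _ = _ := hK
    _ = _ := by
        congr 1
        rw [Real.div_rpow (by norm_num) hd.le, Real.rpow_neg hd.le, Real.mul_rpow (by norm_num) hα.le,
          Real.rpow_add (by norm_num : (0 : ℝ) < 2), ← Real.sqrt_eq_rpow,
          Real.sqrt_mul (by norm_num : (0 : ℝ) ≤ 2)]
        have h2 : √(2 : ℝ) * √2 = 2 := Real.mul_self_sqrt (by norm_num)
        linear_combination (α ^ ν / 2 * √Real.pi * 2 ^ ν * Real.Gamma (ν + 1 / 2) /
          (α ^ 2 - b ^ 2) ^ (ν + 1 / 2)) * h2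

/-! ### The explicit density and its transform -/

theorem productMeanDensity_nonneg {n : ℕ} (hn : 1 ≤ n) {σX σY ρ : ℝ} (hσX : 0 < σX)
    (hσY : 0 < σY) (x : ℝ) : 0 ≤ productMeanDensity n σX σY ρ x := by
  have hn0 : (0 : ℝ) < n := by exact_mod_cast hn
  have hΓ : 0 < Real.Gamma ((n : ℝ) / 2) := Real.Gamma_pos_of_pos (by positivity)
  have hK := besselK_nonneg (((n : ℝ) - 1) / 2) (n * |x| / (σX * σY * (1 - ρ ^ 2)))
  unfold productMeanDensity
  positivity

theorem measurable_productMeanDensity (n : ℕ) (σX σY ρ : ℝ) :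
    Measurable (productMeanDensity n σX σY ρ) := by
  have h := (measurable_besselK (((n : ℝ) - 1) / 2)).comp
    (by fun_prop : Measurable fun x : ℝ => n * |x| / (σX * σY * (1 - ρ ^ 2)))
  simp only [Function.comp_def] at h
  unfold productMeanDensity
  fun_prop

/-- The case D = 1, i.e. total mass one: the prefactor cancels the constant of the Laplace
transform. After taking logarithms the powers cancel by linear algebra. -/
theorem productMeanDensity_normalization {N s r : ℝ} (hN : 0 < N) (hs : 0 < s) (hr : 0 < r) :
    N ^ ((N + 1) / 2) * (2 : ℝ) ^ ((1 - N) / 2)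
        / (s ^ ((N + 1) / 2) * √(Real.pi * r) * Real.Gamma (N / 2))
      * (√Real.pi * (2 * (N / (s * r))) ^ ((N - 1) / 2) * Real.Gamma (N / 2)
        * ((N / (s * r)) ^ 2 * r) ^ (-(N / 2))) = 1 := by
  have hΓ : 0 < Real.Gamma (N / 2) := Real.Gamma_pos_of_pos (by positivity)
  have hπ : 0 < √Real.pi := Real.sqrt_pos.2 Real.pi_pos
  have key : N ^ ((N + 1) / 2) * (2 : ℝ) ^ ((1 - N) / 2) * (2 * (N / (s * r))) ^ ((N - 1) / 2)
      * ((N / (s * r)) ^ 2 * r) ^ (-(N / 2)) = s ^ ((N + 1) / 2) * √r := by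
    rw [Real.sqrt_eq_rpow, Real.rpow_def_of_pos hN, Real.rpow_def_of_pos two_pos,
      Real.rpow_def_of_pos (by positivity), Real.rpow_def_of_pos (by positivity),
      Real.rpow_def_of_pos hs, Real.rpow_def_of_pos hr,
      Real.log_mul (by positivity) (by positivity), Real.log_mul (by positivity) (by positivity),
      Real.log_pow, Real.log_div (by positivity) (by positivity),
      Real.log_mul (by positivity) (by positivity), ← Real.exp_add, ← Real.exp_add,
      ← Real.exp_add, ← Real.exp_add]
    congr 1
    push_cast
    ring
  have hsN : 0 < s ^ ((N + 1) / 2) := Real.rpow_pos_of_pos hs _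
  have hsr : 0 < √r := Real.sqrt_pos.2 hr
  rw [Real.sqrt_mul Real.pi_pos.le, div_mul_eq_mul_div, div_eq_one_iff_eq (by positivity)]
  linear_combination √Real.pi * Real.Gamma (N / 2) * key

theorem lintegral_exp_mul_productMeanDensity {n : ℕ} (hn : 1 ≤ n) {σX σY ρ : ℝ} (hσX : 0 < σX)
    (hσY : 0 < σY) (hρ : -1 < ρ) (hρ' : ρ < 1) {t : ℝ}
    (ht : 0 < 1 - 2 * ρ * (t / n * (σX * σY)) - (1 - ρ ^ 2) * (t / n * (σX * σY)) ^ 2) :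
    ∫⁻ x, ENNReal.ofReal (Real.exp (t * x)) * ENNReal.ofReal (productMeanDensity n σX σY ρ x)
      = ENNReal.ofReal ((√(1 - 2 * ρ * (t / n * (σX * σY))
          - (1 - ρ ^ 2) * (t / n * (σX * σY)) ^ 2))⁻¹ ^ n) := by
  have hn0 : (0 : ℝ) < n := by exact_mod_cast hn
  have hr : 0 < 1 - ρ ^ 2 := by nlinarith
  have hs : 0 < σX * σY := mul_pos hσX hσY
  set N : ℝ := (n : ℝ) with hN
  set s : ℝ := σX * σY with hs'
  set r : ℝ := 1 - ρ ^ 2 with hr'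
  set D : ℝ := 1 - 2 * ρ * (t / N * s) - r * (t / N * s) ^ 2 with hD
  set α : ℝ := N / (s * r) with hα'
  have hα : 0 < α := by positivity
  have hdiff : α ^ 2 - (ρ * α + t) ^ 2 = α ^ 2 * r * D := by
    have hρr : ρ ^ 2 = 1 - r := by rw [hr']; ring
    rw [hD, hα', add_sq, mul_pow, hρr]
    field_simp
    ring
  have hb : |ρ * α + t| < α := by
    refine abs_lt_of_sq_lt_sq ?_ hα.le
    have : 0 < α ^ 2 * r * D := by positivity
    linarith
  have hΓ : 0 < Real.Gamma (N / 2) := Real.Gamma_pos_of_pos (by positivity)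
  set C : ℝ := N ^ ((N + 1) / 2) * (2 : ℝ) ^ ((1 - N) / 2)
    / (s ^ ((N + 1) / 2) * √(Real.pi * r) * Real.Gamma (N / 2)) with hC
  have hCpos : 0 ≤ C := by positivity
  have hL := lintegral_exp_mul_rpow_mul_besselK (ν := (N - 1) / 2) (by linarith) hα hb
  calc _ = ∫⁻ x : ℝ, ENNReal.ofReal C * ENNReal.ofReal (Real.exp ((ρ * α + t) * x) *
          (|x| ^ ((N - 1) / 2) * besselK ((N - 1) / 2) (α * |x|))) := by
        refine lintegral_congr fun x => ?_
        rw [← ENNReal.ofReal_mul (Real.exp_pos _).le, ← ENNReal.ofReal_mul hCpos]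
        congr 1
        rw [productMeanDensity, ← hN, ← hs', ← hr', add_mul, Real.exp_add,
          show ρ * N * x / (s * r) = ρ * α * x by rw [hα']; ring,
          show N * |x| / (s * r) = α * |x| by rw [hα']; ring, hC]
        ring
    _ = _ := by
        rw [lintegral_const_mul' _ _ ENNReal.ofReal_ne_top, hL, ← ENNReal.ofReal_mul hCpos]
        congr 1
        have h := productMeanDensity_normalization hn0 hs hr
        rw [← hC, ← hα'] at h
        rw [show (N - 1) / 2 + 1 / 2 = N / 2 by ring, hdiff,
          Real.mul_rpow (by positivity) ht.le, ← mul_assoc, ← mul_assoc, ← mul_assoc, ← mul_assoc]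
        have hDn : (√D)⁻¹ ^ n = D ^ (-(N / 2)) := by
          rw [Real.sqrt_eq_rpow, ← Real.rpow_neg ht.le, ← Real.rpow_natCast, ← Real.rpow_mul ht.le]
          congr 1
          ring
        rw [hDn]
        linear_combination D ^ (-(N / 2)) * h

/-! ### Comparison of the two transforms -/

/-- The law of the mean of `n` i.i.d. copies `Z i` of the product `X * Y` has the explicit density
`productMeanDensity n σX σY ρ` with respect to Lebesgue measure. -/
theorem mainTheorem1
    {Ω : Type*} [MeasurableSpace Ω] (P : Measure Ω) [IsProbabilityMeasure P]
    {Ω' : Type*} [MeasurableSpace Ω'] (P' : Measure Ω') [IsProbabilityMeasure P']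
    (X Y : Ω → ℝ) (σX σY ρ : ℝ) (hσX : 0 < σX) (hσY : 0 < σY) (hρ : -1 < ρ) (hρ' : ρ < 1)
    (hXY : HasGaussianLaw (fun ω => (X ω, Y ω)) P)
    (hX_mean : ∫ ω, X ω ∂P = 0) (hY_mean : ∫ ω, Y ω ∂P = 0)
    (hX_var : variance X P = σX ^ 2) (hY_var : variance Y P = σY ^ 2)
    (hXY_cov : covariance X Y P = ρ * σX * σY)
    (n : ℕ) (hn : 1 ≤ n) (Z : Fin n → Ω' → ℝ)
    (hZ_indep : iIndepFun Z P')
    (hZ_law : ∀ i, IdentDistrib (Z i) (fun ω => X ω * Y ω) P' P) :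
    Measurable (productMeanDensity n σX σY ρ) ∧
    (∀ x, 0 ≤ productMeanDensity n σX σY ρ x) ∧
    HasLaw (fun ω => (1 / (n : ℝ)) * ∑ i, Z i ω)
      (volume.withDensity (fun x => ENNReal.ofReal (productMeanDensity n σX σY ρ x))) P' := by
  have hmeas := measurable_productMeanDensity n σX σY ρ
  have hn0 : (0 : ℝ) < n := by exact_mod_cast hn
  have hs : 0 < σX * σY := mul_pos hσX hσY
  have hZm : ∀ i, AEMeasurable (Z i) P' := fun i => (hZ_law i).aemeasurable_fst
  have hmean : AEMeasurable (fun ω => (1 / (n : ℝ)) * ∑ i, Z i ω) P' := by fun_prop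
  refine ⟨hmeas, productMeanDensity_nonneg hn hσX hσY, hmean, ?_⟩
  have hD : ∀ t : ℝ, |t| < n / (2 * (σX * σY)) →
      0 < 1 - 2 * ρ * (t / n * (σX * σY)) - (1 - ρ ^ 2) * (t / n * (σX * σY)) ^ 2 := by
    intro t ht
    have hu : |t / n * (σX * σY)| < 1 / 2 := by
      rw [abs_mul, abs_div, abs_of_pos hn0, abs_of_pos hs]
      calc |t| / n * (σX * σY) < n / (2 * (σX * σY)) / n * (σX * σY) := by gcongr
        _ = 1 / 2 := by field_simp
    obtain ⟨h1, h2⟩ := abs_lt.1 hu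
    -- D(u) factors as (1 - u(1+ρ))(1 + u(1-ρ)); both factors are positive for |u| < 1/2 because 1 ±
    -- ρ lies in (0, 2).
    have h3 : 0 < 1 - t / n * (σX * σY) * (1 + ρ) := by nlinarith
    have h4 : 0 < 1 + t / n * (σX * σY) * (1 - ρ) := by nlinarith
    have h5 := mul_pos h3 h4
    linarith
  have hdens : ∀ t : ℝ, |t| < n / (2 * (σX * σY)) →
      ∫⁻ x, ENNReal.ofReal (Real.exp (t * x)) ∂(volume.withDensity
        fun x => ENNReal.ofReal (productMeanDensity n σX σY ρ x))
      = ENNReal.ofReal ((√(1 - 2 * ρ * (t / n * (σX * σY))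
          - (1 - ρ ^ 2) * (t / n * (σX * σY)) ^ 2))⁻¹ ^ n) := by
    intro t ht
    rw [lintegral_withDensity_eq_lintegral_mul _ hmeas.ennreal_ofReal (by fun_prop),
      ← lintegral_exp_mul_productMeanDensity hn hσX hσY hρ hρ' (hD t ht)]
    refine lintegral_congr fun x => ?_
    rw [Pi.mul_apply, mul_comm]
  have hlaw : ∀ t : ℝ, |t| < n / (2 * (σX * σY)) →
      ∫⁻ x, ENNReal.ofReal (Real.exp (t * x)) ∂(P'.map fun ω => (1 / (n : ℝ)) * ∑ i, Z i ω)
      = ENNReal.ofReal ((√(1 - 2 * ρ * (t / n * (σX * σY))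
          - (1 - ρ ^ 2) * (t / n * (σX * σY)) ^ 2))⁻¹ ^ n) := by
    intro t ht
    have hsqrt := Real.sqrt_pos.2 (hD t ht)
    have hone := hXY.lintegral_exp_mul_mul hσX hσY hρ hρ' hX_mean hY_mean hX_var hY_var hXY_cov
      (hD t ht)
    have hXYm : AEMeasurable (fun ω => X ω * Y ω) P :=
      hXY.fst.aemeasurable.mul hXY.snd.aemeasurable
    have hmgfXY : mgf (fun ω => X ω * Y ω) P (t / n) = (√(1 - 2 * ρ * (t / n * (σX * σY))
          - (1 - ρ ^ 2) * (t / n * (σX * σY)) ^ 2))⁻¹ := by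
      rw [mgf, integral_eq_lintegral_of_nonneg_ae
        (Filter.Eventually.of_forall fun _ => (Real.exp_pos _).le)
        (hXYm.const_mul _).exp.aestronglyMeasurable, hone, ENNReal.toReal_ofReal (by positivity)]
    have hmgf : mgf (∑ i, Z i) P' (t / n) = (√(1 - 2 * ρ * (t / n * (σX * σY))
          - (1 - ρ ^ 2) * (t / n * (σX * σY)) ^ 2))⁻¹ ^ n := by
      rw [hZ_indep.mgf_sum₀ hZm]
      simp [fun i => mgf_congr_of_identDistrib _ _ (hZ_law i) (t / n), hmgfXY]
    -- `mgf` would be 0 without integrability, so its positive value proves it.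
    have hint : Integrable (fun ω => Real.exp (t / n * (∑ i, Z i) ω)) P' := by
      refine mgf_pos_iff.1 ?_
      rw [hmgf]
      positivity
    rw [lintegral_map' (by fun_prop) hmean, ← hmgf, mgf,
      ofReal_integral_eq_lintegral_ofReal hint
        (Filter.Eventually.of_forall fun _ => (Real.exp_pos _).le)]
    refine lintegral_congr fun ω => ?_
    rw [Finset.sum_apply, ← mul_assoc, mul_one_div]
  have hδ : 0 < n / (2 * (σX * σY)) := by positivity
  have hfin : IsFiniteMeasure (volume.withDensity
      fun x => ENNReal.ofReal (productMeanDensity n σX σY ρ x)) := by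
    refine ⟨?_⟩
    -- The transform at 0 is the total mass.
    have h := hdens 0 (by simpa using hδ)
    simp only [zero_mul, Real.exp_zero, ENNReal.ofReal_one, lintegral_one] at h
    rw [h]
    exact ENNReal.ofReal_lt_top
  have hprob := Measure.isProbabilityMeasure_map hmean
  refine Measure.ext_of_lintegral_exp_eq hδ (fun t ht => ?_) fun t ht => ?_
  · rw [hlaw t ht]
    exact ENNReal.ofReal_ne_top
  · rw [hlaw t ht, hdens t ht]
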